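/- Let $X\subset\mathbb{R}^n$ and $Z\subseteq X$ be compact basic semi-algebraic sets (each defined by finitely many polynomial inequalities $h_i\ge 0$), let $f:\mathbb{R}^n\to\mathbb{R}^n$ be a polynomial map, and consider the system $x_{t+1}=f(x_t)$. Let $\lambda_A$ be Lebesgue measure restricted to $A$, let $\mathcal{M}_+(A)$ be the set of finite nonnegative Borel measures on $A$ (regarded as measures on $\mathbb{R}^n$), and let $$X_0^\infty=\{x\in X:\ \exists\, t\ge 0,\ f^t(x)\in Z \text{ and } f^s(x)\in X \text{ for all } 0\le s\le t\}.$$ The primal LP is $$p=\sup \int_X 1\,d\mu_0\quad\text{s.t.}\quad \nu+\mu=f_*\nu+\mu_0,\quad \mu_0+\hat\mu_0=\lambda_X,\quad \mu_0,\hat\mu_0,\nu\in\mathcal{M}_+(X),\ \mu\in\mathcal{M}_+(Z),$$ and the dual LP is $$d=\inf\int_X w\,d\lambda_X\quad\text{s.t.}\quad v,w\in\mathcal{C}(X),\quad v(x)-v(f(x))\ge 0 \text{ for } x\in X \text{ with } f(x)\in X,\quad w\ge v+1 \text{ and } w\ge 0 \text{ on } X,\quad v\ge 0\text{ on } Z.$$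 Suppose there is a constant $M>0$ such that $\int_X 1\,d\nu<M$ for every feasible solution $(\mu_0,\hat\mu_0,\nu,\mu)$ of the primal LP. Then: (a) the primal LP has an optimal solution $(\mu_0^*,\hat\mu_0^*,\nu^*,\mu^*)$ with $\mu_0^*=\lambda_{X_0^\infty}$, and $p=\operatorname{vol}(X_0^\infty)$; (b) there is no duality gap: $p=d$, and this common value is finite. If $f(X)\subseteq X$, then the conclusion of (a) also holds under the following weaker assumption in place of the one above: there is $M>0$ such that for every feasible solution $(\mu_0,\hat\mu_0,\nu,\mu)$ there is a feasible solution $(\mu_0,\hat\mu_0,\nu',\mu')$ with the same $\mu_0,\hat\mu_0$ and $\int_X 1\,d\nu'<M$. -/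

import Mathlib

/-- The basic closed semi-algebraic set `{x ∈ ℝⁿ : h i x ≥ 0 for all i}`. -/
def semialgSet {n k : ℕ} (h : Fin k → MvPolynomial (Fin n) ℝ) : Set (Fin n → ℝ) :=
  {x | ∀ i, 0 ≤ MvPolynomial.eval x (h i)}

/-- The polynomial map `ℝⁿ → ℝⁿ` whose `i`-th component is the polynomial `F i`. -/
noncomputable def polyMap {n : ℕ} (F : Fin n → MvPolynomial (Fin n) ℝ) :
    (Fin n → ℝ) → (Fin n → ℝ) :=
  fun x i => MvPolynomial.eval x (F i)

/-- The `T`-step backward reachable set: the points of `X` whose trajectory is in `Z` at some time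
`t ≤ T` and stays in `X` up to that time. -/
def backwardReach {n : ℕ} (X Z : Set (Fin n → ℝ)) (f : (Fin n → ℝ) → (Fin n → ℝ)) (T : ℕ) :
    Set (Fin n → ℝ) :=
  {x | x ∈ X ∧ ∃ t ≤ T, f^[t] x ∈ Z ∧ ∀ s ≤ t, f^[s] x ∈ X}

/-- The backward reachable set `⋃ T, X₀ᵀ`. -/
def backwardReachInf {n : ℕ} (X Z : Set (Fin n → ℝ)) (f : (Fin n → ℝ) → (Fin n → ℝ)) :
    Set (Fin n → ℝ) :=
  ⋃ T : ℕ, backwardReach X Z f T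

/-- `μ ∈ M₊(A)`: a finite nonnegative Borel measure living on `A`, seen as a measure on `ℝⁿ`
that does not charge the complement of `A`. -/
def IsFiniteMeasureOn {n : ℕ} (A : Set (Fin n → ℝ)) (μ : MeasureTheory.Measure (Fin n → ℝ)) :
    Prop :=
  MeasureTheory.IsFiniteMeasure μ ∧ μ Aᶜ = 0

/-- Feasibility of `(μ₀, μ₀', ν, μ)` for the primal LP on measures (`μ₀'` is the slack measure).
The Liouville equation is an equation between measures on `ℝⁿ`. -/
structure PrimalFeasible {n : ℕ} (X Z : Set (Fin n → ℝ)) (f : (Fin n → ℝ) → (Fin n → ℝ))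
    (μ₀ μ₀' ν μ : MeasureTheory.Measure (Fin n → ℝ)) : Prop where
  liouville : ν + μ = MeasureTheory.Measure.map f ν + μ₀
  split : μ₀ + μ₀' = MeasureTheory.volume.restrict X
  init_mem : IsFiniteMeasureOn X μ₀
  slack_mem : IsFiniteMeasureOn X μ₀'
  occ_mem : IsFiniteMeasureOn X ν
  final_mem : IsFiniteMeasureOn Z μ

/-- The set of values of the objective `∫_X 1 dμ₀` over the feasible solutions of the primal LP. -/
def primalValues {n : ℕ} (X Z : Set (Fin n → ℝ)) (f : (Fin n → ℝ) → (Fin n → ℝ)) : Set ℝ :=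
  {p | ∃ μ₀ μ₀' ν μ, PrimalFeasible X Z f μ₀ μ₀' ν μ ∧ p = ∫ _x in X, (1 : ℝ) ∂μ₀}

/-- Optimality for the primal LP: feasible, with the largest objective value. -/
def PrimalOptimal {n : ℕ} (X Z : Set (Fin n → ℝ)) (f : (Fin n → ℝ) → (Fin n → ℝ))
    (μ₀ μ₀' ν μ : MeasureTheory.Measure (Fin n → ℝ)) : Prop :=
  PrimalFeasible X Z f μ₀ μ₀' ν μ ∧ IsGreatest (primalValues X Z f) (∫ _x in X, (1 : ℝ) ∂μ₀)

/-- Feasibility of `(v, w)` for the dual LP on continuous functions. Only the values of `v` and `w`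
on `X` matter; `v (f x)` is meaningful exactly when `f x ∈ X`. -/
structure DualFeasible {n : ℕ} (X Z : Set (Fin n → ℝ)) (f : (Fin n → ℝ) → (Fin n → ℝ))
    (v w : (Fin n → ℝ) → ℝ) : Prop where
  v_cont : ContinuousOn v X
  w_cont : ContinuousOn w X
  decrease : ∀ x ∈ X, f x ∈ X → 0 ≤ v x - v (f x)
  above : ∀ x ∈ X, 0 ≤ w x - v x - 1
  w_nonneg : ∀ x ∈ X, 0 ≤ w x
  v_nonneg : ∀ x ∈ Z, 0 ≤ v x

/-- The set of values of the objective `∫_X w dλ` over the feasible solutions of the dual LP. -/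
def dualValues {n : ℕ} (X Z : Set (Fin n → ℝ)) (f : (Fin n → ℝ) → (Fin n → ℝ)) : Set ℝ :=
  {d | ∃ v w, DualFeasible X Z f v w ∧ d = ∫ x in X, w x}

/-- There is no duality gap: the supremum of the primal LP and the infimum of the dual LP are the
same real number. -/
def NoDualityGap {n : ℕ} (X Z : Set (Fin n → ℝ)) (f : (Fin n → ℝ) → (Fin n → ℝ)) : Prop :=
  ∃ p : ℝ, IsLUB (primalValues X Z f) p ∧ IsGLB (dualValues X Z f) p

/-- The primal LP has an optimal solution whose initial measure is Lebesgue measure restricted to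
the backward reachable set, and its optimal value is the volume of that set. -/
def SolvedByBackwardReach {n : ℕ} (X Z : Set (Fin n → ℝ)) (f : (Fin n → ℝ) → (Fin n → ℝ)) :
    Prop :=
  (∃ μ₀ μ₀' ν μ, PrimalOptimal X Z f μ₀ μ₀' ν μ ∧
    μ₀ = MeasureTheory.volume.restrict (backwardReachInf X Z f)) ∧
  IsLUB (primalValues X Z f) (MeasureTheory.volume.real (backwardReachInf X Z f))

open MeasureTheory Filter Topology Set

/-! Write `A` for `backwardReachInf X Z f`. Off `Z` the Liouville equation reads `ν B = ν (f ⁻¹' B)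
+ μ₀ B`. Points of `X` outside `A` are never mapped into `A`, so for `B = Aᶜ` the first term on the
right is already at least `ν B`; as `ν` is finite, `μ₀ Aᶜ = 0`, whence `p ≤ vol A`. Conversely,
Lebesgue measure on `S ⊆ A`, stopped when it first hits `Z`, is feasible as soon as the hitting time
is integrable on `S` (`exists_primalFeasible_restrict`). For `S = backwardReach X Z f T` the hitting
time is bounded, and every feasible `ν` has mass at least the mean hitting time; so `M` bounds these
means uniformly in `T`, and `T → ∞` gives integrability on `A` itself.

The gap is closed by explicit dual solutions rather than by abstract LP duality. A trajectory
staying in `X` forever would yield an invariant measure (Krylov–Bogoliubov), whose multiples are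
feasible occupation measures of unbounded mass. Hence every trajectory leaves `X`, by compactness
within a uniform time, and this makes the finite-depth `barrier` dual feasible. As its cutoffs
shrink to the indicators of `Z` and `X`, its integral tends to a value at most `vol A`, which weak
duality shows to be a lower bound. -/

theorem continuous_polyMap {n : ℕ} (F : Fin n → MvPolynomial (Fin n) ℝ) :
    Continuous (polyMap F) :=
  continuous_pi fun i => MvPolynomial.continuous_eval (F i)

/-! ### Hitting times, occupation measures and the primal optimum -/

section BackwardReach

variable {n : ℕ} {X Z : Set (Fin n → ℝ)} {f : (Fin n → ℝ) → (Fin n → ℝ)}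

theorem backwardReach_subset (T : ℕ) : backwardReach X Z f T ⊆ X := fun _ hx => hx.1

theorem backwardReachInf_subset : backwardReachInf X Z f ⊆ X :=
  iUnion_subset backwardReach_subset

theorem backwardReach_mono : Monotone (backwardReach X Z f) := by
  rintro S T hST x ⟨hx, t, ht, h⟩
  exact ⟨hx, t, ht.trans hST, h⟩

theorem subset_backwardReach (hZX : Z ⊆ X) (T : ℕ) : Z ⊆ backwardReach X Z f T := by
  intro x hx
  refine ⟨hZX hx, 0, T.zero_le, by simpa using hx, fun s hs => ?_⟩
  obtain rfl : s = 0 := by omega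
  exact hZX hx

theorem subset_backwardReachInf (hZX : Z ⊆ X) : Z ⊆ backwardReachInf X Z f :=
  (subset_backwardReach hZX 0).trans (subset_iUnion _ 0)

theorem mem_backwardReach_succ {T : ℕ} {x : Fin n → ℝ} (hx : x ∈ X)
    (hfx : f x ∈ backwardReach X Z f T) : x ∈ backwardReach X Z f (T + 1) := by
  obtain ⟨-, t, ht, hZ, hs⟩ := hfx
  refine ⟨hx, t + 1, by omega, by simpa using hZ, fun s hst => ?_⟩
  cases s with
  | zero => simpa using hx
  | succ s => simpa using hs s (by omega)

theorem mem_backwardReachInf_of_map_mem {x : Fin n → ℝ} (hx : x ∈ X)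
    (hfx : f x ∈ backwardReachInf X Z f) : x ∈ backwardReachInf X Z f := by
  obtain ⟨T, hT⟩ := mem_iUnion.1 hfx
  exact mem_iUnion.2 ⟨T + 1, mem_backwardReach_succ hx hT⟩

theorem iterate_mem_of_mem_diff {t : ℕ} {x : Fin n → ℝ}
    (hx : x ∈ backwardReachInf X Z f \ backwardReach X Z f t) : f^[t] x ∈ X := by
  obtain ⟨T, hxX, s, -, hZ, hs⟩ := mem_iUnion.1 hx.1
  by_cases hst : s ≤ t
  · exact absurd ⟨hxX, s, hst, hZ, hs⟩ hx.2
  · exact hs t (by omega)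

/-- The `t`-th disjointed piece consists of the points whose first hitting time of `Z` is exactly
`t`. -/
theorem iterate_mem_of_mem_disjointed {t : ℕ} {x : Fin n → ℝ}
    (hx : x ∈ disjointed (backwardReach X Z f) t) : f^[t] x ∈ Z := by
  obtain ⟨hxX, s, hst, hZ, hs⟩ := disjointed_subset _ _ hx
  rcases hst.eq_or_lt with rfl | hlt
  · exact hZ
  · rw [disjointed_apply] at hx
    refine absurd ?_ hx.2
    simp only [Finset.sup_eq_iSup, iSup_eq_iUnion, mem_iUnion]
    exact ⟨s, by simpa using hlt, hxX, s, le_rfl, hZ, hs⟩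

theorem measurableSet_backwardReach (hf : Continuous f) (hX : MeasurableSet X) (hZ : MeasurableSet Z)
    (T : ℕ) : MeasurableSet (backwardReach X Z f T) := by
  have : backwardReach X Z f T =
      X ∩ ⋃ t ≤ T, (f^[t] ⁻¹' Z ∩ ⋂ s ≤ t, f^[s] ⁻¹' X) := by
    ext x
    simp only [backwardReach, mem_ofPred_eq, mem_inter_iff, mem_iUnion, mem_iInter, mem_preimage,
      exists_prop]
  rw [this]
  have hm : ∀ t, Measurable f^[t] := fun t => (hf.iterate t).measurable
  exact hX.inter <| .iUnion fun t => .iUnion fun _ =>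
    (hm t hZ).inter <| .iInter fun s => .iInter fun _ => hm s hX

theorem measurableSet_backwardReachInf (hf : Continuous f) (hX : MeasurableSet X) (hZ : MeasurableSet Z) :
    MeasurableSet (backwardReachInf X Z f) :=
  .iUnion fun T => measurableSet_backwardReach hf hX hZ T

theorem PrimalFeasible.apply_add_apply {μ₀ μ₀' ν μ : Measure (Fin n → ℝ)}
    (h : PrimalFeasible X Z f μ₀ μ₀' ν μ) (hf : Continuous f) {B : Set (Fin n → ℝ)}
    (hB : MeasurableSet B) (hBZ : B ⊆ Zᶜ) : ν B = ν (f ⁻¹' B) + μ₀ B := by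
  have := congrArg (fun m : Measure (Fin n → ℝ) => m B) h.liouville
  simpa [Measure.map_apply hf.measurable hB, measure_mono_null hBZ h.final_mem.2] using this

theorem PrimalFeasible.apply_le_apply {μ₀ μ₀' ν μ : Measure (Fin n → ℝ)}
    (h : PrimalFeasible X Z f μ₀ μ₀' ν μ) {B C : Set (Fin n → ℝ)} (hBC : B ∩ X ⊆ C) :
    ν B ≤ ν C := by
  calc ν B ≤ ν (C ∪ Xᶜ) := measure_mono fun x hx => by
        by_cases hxX : x ∈ X
        · exact Or.inl (hBC ⟨hx, hxX⟩)
        · exact Or.inr hxX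
    _ ≤ ν C + ν Xᶜ := measure_union_le _ _
    _ = ν C := by rw [h.occ_mem.2, add_zero]

/-- The initial measure of a feasible solution does not charge the complement of the backward
reachable set. -/
theorem PrimalFeasible.init_compl_backwardReachInf {μ₀ μ₀' ν μ : Measure (Fin n → ℝ)}
    (h : PrimalFeasible X Z f μ₀ μ₀' ν μ) (hf : Continuous f) (hX : MeasurableSet X)
    (hZ : MeasurableSet Z) (hZX : Z ⊆ X) : μ₀ (backwardReachInf X Z f)ᶜ = 0 := by
  have := h.occ_mem.1
  have key := h.apply_add_apply hf (measurableSet_backwardReachInf hf hX hZ).compl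
    (compl_subset_compl.2 (subset_backwardReachInf hZX))
  have hle : ν (backwardReachInf X Z f)ᶜ ≤ ν (f ⁻¹' (backwardReachInf X Z f)ᶜ) :=
    h.apply_le_apply fun x hx hfx => hx.1 (mem_backwardReachInf_of_map_mem hx.2 hfx)
  rw [key] at hle
  have hfin : ν (f ⁻¹' (backwardReachInf X Z f)ᶜ) ≠ ⊤ := measure_ne_top _ _
  exact nonpos_iff_eq_zero.1 ((ENNReal.add_le_add_iff_left hfin).1 (by simpa using hle))

theorem PrimalFeasible.init_apply_le {μ₀ μ₀' ν μ : Measure (Fin n → ℝ)}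
    (h : PrimalFeasible X Z f μ₀ μ₀' ν μ) (hf : Continuous f) (hX : MeasurableSet X)
    (hZ : MeasurableSet Z) (hZX : Z ⊆ X) : μ₀ X ≤ volume (backwardReachInf X Z f) := by
  have hA := measurableSet_backwardReachInf hf hX hZ
  have h0 := h.init_compl_backwardReachInf hf hX hZ hZX
  calc μ₀ X ≤ μ₀ (backwardReachInf X Z f ∪ (backwardReachInf X Z f)ᶜ) :=
        measure_mono (by simp)
    _ ≤ μ₀ (backwardReachInf X Z f) := by
        simpa [h0] using measure_union_le (μ := μ₀) (backwardReachInf X Z f)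
          (backwardReachInf X Z f)ᶜ
    _ ≤ (μ₀ + μ₀') (backwardReachInf X Z f) := by simp
    _ = volume (backwardReachInf X Z f) := by
        rw [h.split, Measure.restrict_apply hA, inter_eq_left.2 backwardReachInf_subset]

/-- The mean hitting time of `Z` under the initial measure is at most the occupation mass. -/
theorem PrimalFeasible.sum_init_compl_backwardReach_le {μ₀ μ₀' ν μ : Measure (Fin n → ℝ)}
    (h : PrimalFeasible X Z f μ₀ μ₀' ν μ) (hf : Continuous f) (hX : MeasurableSet X)
    (hZ : MeasurableSet Z) (hZX : Z ⊆ X) (K : ℕ) :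
    ∑ t ∈ Finset.range K, μ₀ (backwardReach X Z f t)ᶜ ≤ ν univ := by
  -- The extra `ν` term makes the induction telescope: the Liouville equation at level `K` releases
  -- one `μ₀` summand and pushes the rest to level `K + 1`.
  suffices ∑ t ∈ Finset.range K, μ₀ (backwardReach X Z f t)ᶜ + ν (backwardReach X Z f K)ᶜ ≤
      ν univ from le_self_add.trans this
  induction K with
  | zero => simpa using measure_mono (subset_univ _)
  | succ K ih =>
    refine le_trans ?_ ih
    have hle : ν (backwardReach X Z f (K + 1))ᶜ ≤ ν (f ⁻¹' (backwardReach X Z f K)ᶜ) :=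
      h.apply_le_apply fun x hx hfx => hx.1 (mem_backwardReach_succ hx.2 hfx)
    rw [Finset.sum_range_succ, add_assoc, h.apply_add_apply hf
      (measurableSet_backwardReach hf hX hZ K).compl
      (compl_subset_compl.2 (subset_backwardReach hZX K)), add_comm (ν _)]
    gcongr

theorem setIntegral_one_eq {μ : Measure (Fin n → ℝ)} :
    ∫ _x in X, (1 : ℝ) ∂μ = μ.real X := by
  simp

theorem sum_map_iterate_succ {ρ : ℕ → Measure (Fin n → ℝ)} (hf : Continuous f) :
    (Measure.sum fun t => (ρ t).map f^[t + 1]) =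
      (Measure.sum fun t => (ρ t).map f^[t]).map f := by
  rw [Measure.map_sum hf.measurable.aemeasurable]
  congr 1
  funext t
  rw [Measure.map_map hf.measurable (hf.iterate t).measurable, Function.iterate_succ']

/-- Lebesgue measure on a part `S` of the backward reachable set with integrable hitting time
is the initial measure of the feasible solution obtained by stopping when `Z` is first hit. -/
theorem exists_primalFeasible_restrict (hf : Continuous f) (hX : MeasurableSet X)
    (hZ : MeasurableSet Z) (hXfin : volume X ≠ ⊤) {S : Set (Fin n → ℝ)} (hS : MeasurableSet S)
    (hSA : S ⊆ backwardReachInf X Z f)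
    (hsum : ∑' t, volume (S \ backwardReach X Z f t) ≠ ⊤) :
    ∃ ν μ, PrimalFeasible X Z f (volume.restrict S) (volume.restrict (X \ S)) ν μ := by
  have hSX : S ⊆ X := hSA.trans backwardReachInf_subset
  have hA := measurableSet_backwardReach hf hX hZ
  have hm : ∀ t, Measurable f^[t] := fun t => (hf.iterate t).measurable
  set D : ℕ → Set (Fin n → ℝ) := fun t => S ∩ disjointed (backwardReach X Z f) t with hD
  have hDm : ∀ t, MeasurableSet (D t) := fun t => hS.inter (.disjointed hA t)
  have hDd : Pairwise (Function.onFun Disjoint D) := fun i j hij =>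
    (disjoint_disjointed (backwardReach X Z f) hij).mono inter_subset_right inter_subset_right
  -- `ν` records the positions strictly before the first hit of `Z`, `μ` the position at that hit.
  set ν := Measure.sum fun t => (volume.restrict (S \ backwardReach X Z f t)).map f^[t]
  set μ := Measure.sum fun t => (volume.restrict (D t)).map f^[t]
  -- The points of `S` with no hit before time `t`. Since `E 0 = S` and `E (t + 1)` carries the
  -- `t`-th term of `ν`, splitting off `t = 0` from `ν + μ` is the Liouville equation.
  set E : ℕ → Set (Fin n → ℝ) := fun t => S \ backwardReach X Z f t ∪ D t with hE
  have hE0 : E 0 = S := by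
    simp only [hE, hD, disjointed_zero]
    exact sdiff_union_inter _ _
  have hEs : ∀ t, E (t + 1) = S \ backwardReach X Z f t := fun t => by
    have := backwardReach_mono (X := X) (Z := Z) (f := f) t.le_succ
    simp only [hE, hD, backwardReach_mono.disjointed_add_one]
    ext x
    have := @this x
    simp only [mem_union, Set.mem_sdiff, mem_inter_iff]
    tauto
  have hsumE : ν + μ = Measure.sum fun t => (volume.restrict (E t)).map f^[t] := by
    rw [Measure.sum_add_sum]
    congr 1
    funext t
    rw [← Measure.map_add _ _ (hm t), hE, Measure.restrict_union _ (hDm t)]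
    exact disjoint_left.2 fun x hx hx' => hx.2 (disjointed_subset _ _ hx'.2)
  refine ⟨ν, μ, ?_, ?_, ⟨⟨?_⟩, ?_⟩, ⟨⟨?_⟩, ?_⟩, ⟨⟨?_⟩, ?_⟩, ⟨⟨?_⟩, ?_⟩⟩
  · have hshift : (Measure.sum fun t => (volume.restrict (E t)).map f^[t]) =
        (Measure.sum fun t => (volume.restrict (E (t + 1))).map f^[t + 1]) +
          volume.restrict S := by
      ext B hB
      rw [Measure.sum_apply _ hB, Measure.add_apply, Measure.sum_apply _ hB,
        tsum_eq_zero_add' ENNReal.summable, add_comm]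
      simp [hE0]
    rw [hsumE, hshift]
    simp only [hEs]
    rw [sum_map_iterate_succ hf]
  · rw [← Measure.restrict_union disjoint_sdiff_right (hX.diff hS), union_sdiff_cancel hSX]
  · simpa using (measure_mono hSX).trans_lt hXfin.lt_top
  · rw [Measure.restrict_apply hX.compl]
    rw [inter_comm, ← Set.sdiff_eq, sdiff_eq_empty.2 hSX, measure_empty]
  · simpa using (measure_mono sdiff_subset).trans_lt hXfin.lt_top
  · rw [Measure.restrict_apply hX.compl, show Xᶜ ∩ (X \ S) = ∅ by ext; simp; tauto, measure_empty]
  · simpa [ν, Measure.sum_apply _ MeasurableSet.univ, Measure.map_apply (hm _) MeasurableSet.univ]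
      using hsum.lt_top
  · rw [Measure.sum_apply _ hX.compl, ENNReal.tsum_eq_zero]
    intro t
    rw [Measure.map_apply (hm t) hX.compl, Measure.restrict_apply (hm t hX.compl)]
    convert measure_empty (μ := (volume : Measure (Fin n → ℝ)))
    refine eq_empty_of_forall_notMem fun x hx => hx.1 (iterate_mem_of_mem_diff ⟨hSA hx.2.1, hx.2.2⟩)
  · rw [Measure.sum_apply _ MeasurableSet.univ]
    simp only [Measure.map_apply (hm _) MeasurableSet.univ, preimage_univ,
      Measure.restrict_apply_univ]
    rw [← measure_iUnion hDd hDm]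
    exact (measure_mono (iUnion_subset fun t => inter_subset_left.trans hSX)).trans_lt
      hXfin.lt_top
  · rw [Measure.sum_apply _ hZ.compl, ENNReal.tsum_eq_zero]
    intro t
    rw [Measure.map_apply (hm t) hZ.compl, Measure.restrict_apply (hm t hZ.compl)]
    convert measure_empty (μ := (volume : Measure (Fin n → ℝ)))
    exact eq_empty_of_forall_notMem fun x hx => hx.1 (iterate_mem_of_mem_disjointed hx.2.2)

/-- If every initial measure has a feasible solution of bounded occupation mass, the hitting time
of `Z` is integrable on the backward reachable set. -/
theorem tsum_diff_backwardReach_ne_top (hf : Continuous f) (hX : MeasurableSet X)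
    (hZ : MeasurableSet Z) (hZX : Z ⊆ X) (hXfin : volume X ≠ ⊤) {M : ℝ}
    (hM : ∀ μ₀ μ₀' ν μ, PrimalFeasible X Z f μ₀ μ₀' ν μ →
      ∃ ν' μ', PrimalFeasible X Z f μ₀ μ₀' ν' μ' ∧ ∫ _x in X, (1 : ℝ) ∂ν' < M) :
    ∑' t, volume (backwardReachInf X Z f \ backwardReach X Z f t) ≠ ⊤ := by
  have hA := measurableSet_backwardReach hf hX hZ
  -- Truncating at `T` leaves only finitely many nonzero terms, so feasibility needs no bound; `hM`
  -- then supplies one independent of both `K` and `T`.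
  have hbound : ∀ K T, ∑ t ∈ Finset.range K,
      volume (backwardReach X Z f T \ backwardReach X Z f t) ≤ ENNReal.ofReal M := by
    intro K T
    obtain ⟨ν, μ, hfeas⟩ := exists_primalFeasible_restrict hf hX hZ hXfin (hA T)
      (subset_iUnion _ T) (by
        rw [tsum_eq_sum (s := Finset.range T)]
        · exact ENNReal.sum_ne_top.2 fun t _ => ne_top_of_le_ne_top hXfin
            (measure_mono (sdiff_subset.trans (backwardReach_subset T)))
        · intro t ht
          rw [sdiff_eq_empty.2 (backwardReach_mono (by simpa using ht)), measure_empty])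
    obtain ⟨ν', μ', h', hlt⟩ := hM _ _ _ _ hfeas
    have := h'.occ_mem.1
    have hν : ν' univ ≤ ENNReal.ofReal M := by
      rw [setIntegral_one_eq] at hlt
      calc ν' univ ≤ ν' X := h'.apply_le_apply (by simp)
        _ = ENNReal.ofReal (ν'.real X) := by simp
        _ ≤ ENNReal.ofReal M := ENNReal.ofReal_le_ofReal hlt.le
    refine le_trans (le_of_eq ?_) ((h'.sum_init_compl_backwardReach_le hf hX hZ hZX K).trans hν)
    refine Finset.sum_congr rfl fun t _ => ?_
    rw [Measure.restrict_apply (hA t).compl, inter_comm, Set.sdiff_eq]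
  refine ne_top_of_le_ne_top (ENNReal.ofReal_ne_top (r := M)) ?_
  rw [ENNReal.tsum_eq_iSup_nat]
  refine iSup_le fun K => ?_
  refine le_of_tendsto' (x := atTop) (tendsto_finsetSum (Finset.range K) fun t _ => ?_) (hbound K)
  rw [backwardReachInf, iUnion_sdiff]
  exact tendsto_measure_iUnion_atTop fun _ _ h => sdiff_subset_sdiff_left (backwardReach_mono h)

theorem solvedByBackwardReach_of_bound (hf : Continuous f) (hX : MeasurableSet X)
    (hZ : MeasurableSet Z) (hZX : Z ⊆ X) (hXfin : volume X ≠ ⊤) {M : ℝ}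
    (hM : ∀ μ₀ μ₀' ν μ, PrimalFeasible X Z f μ₀ μ₀' ν μ →
      ∃ ν' μ', PrimalFeasible X Z f μ₀ μ₀' ν' μ' ∧ ∫ _x in X, (1 : ℝ) ∂ν' < M) :
    SolvedByBackwardReach X Z f := by
  have hA := measurableSet_backwardReachInf hf hX hZ
  obtain ⟨ν, μ, hfeas⟩ := exists_primalFeasible_restrict hf hX hZ hXfin hA subset_rfl
    (tsum_diff_backwardReach_ne_top hf hX hZ hZX hXfin hM)
  have hval : ∫ _x in X, (1 : ℝ) ∂(volume.restrict (backwardReachInf X Z f)) =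
      volume.real (backwardReachInf X Z f) := by
    rw [setIntegral_one_eq, measureReal_restrict_apply hX,
      inter_eq_right.2 backwardReachInf_subset]
  have hgreatest : IsGreatest (primalValues X Z f)
      (volume.real (backwardReachInf X Z f)) := by
    refine ⟨⟨_, _, ν, μ, hfeas, hval.symm⟩, ?_⟩
    rintro _ ⟨μ₀, μ₀', ν', μ', h, rfl⟩
    rw [setIntegral_one_eq]
    exact ENNReal.toReal_mono (ne_top_of_le_ne_top hXfin (measure_mono backwardReachInf_subset))
      (h.init_apply_le hf hX hZ hZX)
  exact ⟨⟨_, _, ν, μ, ⟨hfeas, hval ▸ hgreatest⟩, rfl⟩, hgreatest.isLUB⟩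

end BackwardReach

/-! ### Invariant measures and escape from `X` -/

section InvariantMeasure

/-- The witness is the empirical measure of an orbit segment; taking `N + 1` points keeps it a
probability measure at `N = 0`. -/
theorem exists_probabilityMeasure_integral_eq_birkhoffAverage {K : Type*} [MeasurableSpace K]
    [MetricSpace K] [BorelSpace K] (g : K → K) (x : K) (N : ℕ) :
    ∃ P : ProbabilityMeasure K, ∀ φ : BoundedContinuousFunction K ℝ,
      ∫ y, φ y ∂(P : Measure K) = birkhoffAverage ℝ g φ (N + 1) x := by
  have hN : ((N : ENNReal) + 1) ≠ 0 := by positivity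
  have hN' : ((N : ENNReal) + 1) ≠ ⊤ := by finiteness
  refine ⟨⟨((N : ENNReal) + 1)⁻¹ • ∑ k ∈ Finset.range (N + 1), Measure.dirac (g^[k] x), ⟨?_⟩⟩, ?_⟩
  · simp [ENNReal.inv_mul_cancel hN hN']
  · intro φ
    have hint : ∀ k ∈ Finset.range (N + 1), Integrable φ (Measure.dirac (g^[k] x)) :=
      fun k _ => φ.integrable _
    simp only [ProbabilityMeasure.coe_mk, integral_smul_measure]
    rw [integral_finsetSum_measure hint]
    simp only [integral_dirac, birkhoffAverage, birkhoffSum]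
    congr 1
    rw [ENNReal.toReal_inv]
    norm_cast

/-- **Krylov–Bogoliubov theorem**: a continuous self-map of a nonempty compact metric space has an
invariant Borel probability measure. -/
theorem exists_invariant_probabilityMeasure {K : Type*} [MeasurableSpace K] [MetricSpace K]
    [BorelSpace K] [CompactSpace K] [Nonempty K] {g : K → K} (hg : Continuous g) :
    ∃ P : Measure K, IsProbabilityMeasure P ∧ P.map g = P := by
  obtain ⟨x⟩ := ‹Nonempty K›
  choose P hP using exists_probabilityMeasure_integral_eq_birkhoffAverage g x
  -- A limit along a nonprincipal ultrafilter replaces the extraction of a convergent subsequence.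
  obtain ⟨Q, -, hQ⟩ := isCompact_iff_ultrafilter_le_nhds.1
    (isCompact_univ (X := ProbabilityMeasure K)) ((hyperfilter ℕ).map P) (by simp)
  have hle : (hyperfilter ℕ : Filter ℕ) ≤ atTop := by
    rw [← Nat.cofinite_eq_atTop]
    exact hyperfilter_le_cofinite
  have hQ' : Tendsto P (hyperfilter ℕ) (𝓝 Q) := hQ
  rw [ProbabilityMeasure.tendsto_iff_forall_integral_tendsto] at hQ'
  refine ⟨Q, inferInstance, ?_⟩
  have : IsFiniteMeasure ((Q : Measure K).map g) := Measure.isFiniteMeasure_map _ _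
  refine ext_of_forall_integral_eq_of_IsFiniteMeasure fun φ => ?_
  rw [integral_map hg.measurable.aemeasurable φ.continuous.aestronglyMeasurable]
  have h1 := (hQ' (φ.compContinuous ⟨g, hg⟩)).sub (hQ' φ)
  have h2 : Tendsto (fun N => birkhoffAverage ℝ g φ N (g x) - birkhoffAverage ℝ g φ N x)
      atTop (𝓝 0) :=
    tendsto_birkhoffAverage_apply_sub_birkhoffAverage' ℝ φ.isBounded_range g x
  have h3 := ((tendsto_add_atTop_iff_nat 1).2 h2).mono_left hle
  refine sub_eq_zero.1 (tendsto_nhds_unique h1 (h3.congr fun N => ?_))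
  simp only [hP, birkhoffAverage, birkhoffSum]
  simp only [← Function.iterate_succ_apply, Function.iterate_succ_apply',
    BoundedContinuousFunction.compContinuous_apply, ContinuousMap.coe_mk]

variable {n : ℕ} {X Z : Set (Fin n → ℝ)} {f : (Fin n → ℝ) → (Fin n → ℝ)}

theorem exists_invariant_measure_of_forall_iterate_mem (hf : Continuous f) (hX : IsCompact X)
    {x : Fin n → ℝ} (hx : ∀ s, f^[s] x ∈ X) :
    ∃ ν : Measure (Fin n → ℝ), IsProbabilityMeasure ν ∧ ν Xᶜ = 0 ∧ ν.map f = ν := by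
  -- This set is closed and mapped into itself by `f`, even when `X` is not invariant.
  set K : Set (Fin n → ℝ) := {y | ∀ s, f^[s] y ∈ X} with hK
  have hKX : K ⊆ X := fun y hy => hy 0
  have hKc : IsCompact K := hX.of_isClosed_subset (by
    simp only [hK, ofPred_forall]
    exact isClosed_iInter fun s => hX.isClosed.preimage (hf.iterate s)) hKX
  have hmaps : MapsTo f K K := fun y hy s => by
    simpa using hy (s + 1)
  have : CompactSpace K := isCompact_iff_compactSpace.1 hKc
  have : Nonempty K := ⟨⟨x, hx⟩⟩
  obtain ⟨P, hP, hinv⟩ := exists_invariant_probabilityMeasure (hf.restrict hmaps)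
  refine ⟨P.map Subtype.val, Measure.isProbabilityMeasure_map measurable_subtype_coe.aemeasurable,
    ?_, ?_⟩
  · rw [Measure.map_apply measurable_subtype_coe hX.measurableSet.compl]
    convert measure_empty (μ := P)
    exact eq_empty_of_forall_notMem fun y hy => hy (hKX y.2)
  · nth_rw 2 [← hinv]
    rw [Measure.map_map hf.measurable measurable_subtype_coe,
      Measure.map_map measurable_subtype_coe (hf.restrict hmaps).measurable]
    rfl

/-- If the occupation mass of feasible solutions is bounded, every trajectory leaves `X`. -/
theorem exists_iterate_notMem_of_bound (hf : Continuous f) (hX : IsCompact X) {M : ℝ}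
    (hM : ∀ μ₀ μ₀' ν μ, PrimalFeasible X Z f μ₀ μ₀' ν μ → ∫ _x in X, (1 : ℝ) ∂ν < M)
    (x : Fin n → ℝ) : ∃ s, f^[s] x ∉ X := by
  by_contra! hx
  obtain ⟨ν, hν, hνX, hinv⟩ := exists_invariant_measure_of_forall_iterate_mem hf hX hx
  have hνX' : ν X = 1 := (prob_compl_eq_zero_iff hX.measurableSet).1 hνX
  -- The scaled invariant measure solves the Liouville equation with zero initial and final
  -- measures; its mass is `max M 0`, which is not below `M`.
  have hfeas : PrimalFeasible X Z f 0 (volume.restrict X) (ENNReal.ofReal M • ν) 0 := by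
    refine ⟨?_, by simp, ⟨inferInstance, by simp⟩, ⟨⟨?_⟩, ?_⟩, ⟨⟨?_⟩, ?_⟩,
      ⟨inferInstance, by simp⟩⟩
    · rw [Measure.map_smul, hinv]
    · simpa using hX.measure_lt_top
    · simp [Measure.restrict_apply hX.measurableSet.compl]
    · simp
    · simp [hνX]
  have := hM _ _ _ _ hfeas
  rw [setIntegral_one_eq] at this
  simp [Measure.real, hνX', ENNReal.toReal_ofReal'] at this

end InvariantMeasure

/-! ### A finite-horizon value function with cutoffs -/

section Barrier

variable {E : Type*}

/-- The largest value of `g (f^[s] x) * ∏ 1 ≤ j ≤ s, χ (f^[j] x)` over `s ≤ k`. -/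
noncomputable def barrier (f : E → E) (g χ : E → ℝ) : ℕ → E → ℝ
  | 0, x => g x
  | k + 1, x => max (g x) (χ (f x) * barrier f g χ k (f x))

variable {f : E → E} {g χ : E → ℝ}

theorem continuous_barrier [TopologicalSpace E] (hf : Continuous f) (hg : Continuous g)
    (hχ : Continuous χ) (k : ℕ) : Continuous (barrier f g χ k) := by
  induction k with
  | zero => exact hg
  | succ k ih => exact hg.max ((hχ.comp hf).mul (ih.comp hf))

theorem le_barrier (k : ℕ) (x : E) : g x ≤ barrier f g χ k x := by
  cases k with
  | zero => exact le_rfl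
  | succ k => exact le_max_left _ _

theorem barrier_nonneg (hg : ∀ x, 0 ≤ g x) (k : ℕ) (x : E) : 0 ≤ barrier f g χ k x :=
  (hg x).trans (le_barrier k x)

theorem barrier_le_one (hg : ∀ x, g x ≤ 1) (hχ0 : ∀ x, 0 ≤ χ x) (hχ1 : ∀ x, χ x ≤ 1)
    (k : ℕ) (x : E) : barrier f g χ k x ≤ 1 := by
  induction k generalizing x with
  | zero => exact hg x
  | succ k ih =>
    refine max_le (hg x) ?_
    calc χ (f x) * barrier f g χ k (f x) ≤ χ (f x) * 1 :=
          mul_le_mul_of_nonneg_left (ih _) (hχ0 _)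
      _ ≤ 1 := by simpa using hχ1 _

/-- A vanishing factor cuts the recursion off within the first `k + 1` steps, so extra depth
contributes only a zero, which the maximum with `g ≥ 0` absorbs. -/
theorem barrier_succ_eq (hg : ∀ x, 0 ≤ g x) {k : ℕ} {x : E}
    (h : ∃ s ≤ k, χ (f^[s + 1] x) = 0) : barrier f g χ (k + 1) x = barrier f g χ k x := by
  induction k generalizing x with
  | zero =>
    obtain ⟨s, hs, h⟩ := h
    obtain rfl : s = 0 := by omega
    replace h : χ (f x) = 0 := by simpa using h
    simp [barrier, h, hg x]
  | succ k ih =>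
    obtain ⟨s, hs, h⟩ := h
    cases s with
    | zero =>
      replace h : χ (f x) = 0 := by simpa using h
      simp [barrier, h]
    | succ s =>
      rw [barrier, ih ⟨s, by omega, h⟩, barrier]

/-- Depth `k` at `f x` is a term of depth `k + 1` at `x`, and the vanishing factor lets the depth
drop back to `k`. This gives the dual decrease condition. -/
theorem barrier_map_le (hg : ∀ x, 0 ≤ g x) {k : ℕ} {x : E}
    (h : ∃ s ≤ k, χ (f^[s + 1] x) = 0) (hfx : χ (f x) = 1) :
    barrier f g χ k (f x) ≤ barrier f g χ k x := by
  rw [← barrier_succ_eq hg h, barrier, hfx, one_mul]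
  exact le_max_right _ _

theorem tendsto_barrier {ι : Type*} {l : Filter ι} {gs χs : ι → E → ℝ}
    (hg : ∀ x, Tendsto (gs · x) l (𝓝 (g x))) (hχ : ∀ x, Tendsto (χs · x) l (𝓝 (χ x)))
    (k : ℕ) (x : E) :
    Tendsto (fun i => barrier f (gs i) (χs i) k x) l (𝓝 (barrier f g χ k x)) := by
  induction k generalizing x with
  | zero => exact hg x
  | succ k ih => exact (hg x).max ((hχ _).mul (ih _))

/-- With sharp indicators, a nonzero term would be a visit to `Z` by time `T` along a trajectory in
`X`. -/
theorem barrier_indicator_eq_zero {n : ℕ} {X Z : Set (Fin n → ℝ)}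
    {f : (Fin n → ℝ) → (Fin n → ℝ)} (hZX : Z ⊆ X) {T : ℕ} {x : Fin n → ℝ} (hx : x ∈ X)
    (hxT : x ∉ backwardReach X Z f T) : barrier f (Z.indicator 1) (X.indicator 1) T x = 0 := by
  induction T generalizing x with
  | zero => simpa [barrier] using fun h => hxT (subset_backwardReach hZX 0 h)
  | succ T ih =>
    have hxZ : x ∉ Z := fun h => hxT (subset_backwardReach hZX _ h)
    by_cases hfx : f x ∈ X
    · simp [barrier, hxZ, ih hfx fun h => hxT (mem_backwardReach_succ hx h)]
    · simp [barrier, hxZ, hfx]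

end Barrier

/-! ### Weak duality and near-optimal dual solutions -/

section Duality

variable {n : ℕ} {X Z : Set (Fin n → ℝ)} {f : (Fin n → ℝ) → (Fin n → ℝ)}

theorem DualFeasible.nonneg_of_mem_backwardReach {v w : (Fin n → ℝ) → ℝ}
    (h : DualFeasible X Z f v w) {x : Fin n → ℝ} {t : ℕ} (hZ : f^[t] x ∈ Z)
    (hX : ∀ s ≤ t, f^[s] x ∈ X) : 0 ≤ v x := by
  induction t generalizing x with
  | zero => exact h.v_nonneg x hZ
  | succ t ih =>
    have h1 := ih (x := f x) hZ fun s hs => hX (s + 1) (by omega)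
    have h2 := h.decrease x (hX 0 (by omega)) (hX 1 (by omega))
    linarith

/-- Weak duality against the volume of the backward reachable set. -/
theorem DualFeasible.volume_le {v w : (Fin n → ℝ) → ℝ} (h : DualFeasible X Z f v w)
    (hf : Continuous f) (hX : IsCompact X) (hZ : MeasurableSet Z) :
    volume.real (backwardReachInf X Z f) ≤ ∫ x in X, w x := by
  have hA := measurableSet_backwardReachInf hf hX.measurableSet hZ
  have hval : ∫ x in X, (backwardReachInf X Z f).indicator (fun _ => (1 : ℝ)) x =
      volume.real (backwardReachInf X Z f) := by
    rw [integral_indicator_const _ hA, measureReal_restrict_apply hA,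
      inter_eq_left.2 backwardReachInf_subset]
    simp
  rw [← hval]
  refine setIntegral_mono_on ?_ (h.w_cont.integrableOn_compact hX) hX.measurableSet fun x hx => ?_
  · have : IsFiniteMeasure (volume.restrict X) := ⟨by simpa using hX.measure_lt_top⟩
    exact (integrable_const _).indicator hA
  · by_cases hxA : x ∈ backwardReachInf X Z f
    · obtain ⟨T, -, t, -, htZ, htX⟩ := mem_iUnion.1 hxA
      have h1 := h.nonneg_of_mem_backwardReach htZ htX
      have h2 := h.above x hx
      rw [indicator_of_mem hxA]
      linarith
    · simpa [indicator_of_notMem hxA] using h.w_nonneg x hx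

theorem dualFeasible_barrier (hf : Continuous f) {g χ : (Fin n → ℝ) → ℝ}
    (hg : Continuous g) (hχ : Continuous χ) (hg0 : ∀ x, 0 ≤ g x) (hgZ : ∀ x ∈ Z, g x = 1)
    (hχX : ∀ x ∈ X, χ x = 1) {k : ℕ} (hk : ∀ x ∈ X, ∃ s ≤ k, χ (f^[s + 1] x) = 0) :
    DualFeasible X Z f (fun x => barrier f g χ k x - 1) (barrier f g χ k) := by
  have hc := continuous_barrier hf hg hχ k
  refine ⟨(hc.sub continuous_const).continuousOn, hc.continuousOn, ?_, fun x _ => by simp,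
    fun x _ => barrier_nonneg hg0 k x, fun x hx => ?_⟩
  · intro x hx hfx
    have := barrier_map_le hg0 (hk x hx) (hχX _ hfx)
    linarith
  · have := le_barrier (f := f) (g := g) (χ := χ) k x
    rw [hgZ x hx] at this
    linarith

/-- If every trajectory leaves the compact set `X`, then there are a uniform time and a uniform
distance from `X` for this. -/
theorem exists_uniform_exit (hf : Continuous f) (hX : IsCompact X)
    (hexit : ∀ x, ∃ s, f^[s] x ∉ X) {δ : ℕ → ℝ} (hδ : Antitone δ)
    (hδ0 : Tendsto δ atTop (𝓝 0)) :
    ∃ m, ∀ x ∈ X, ∃ s ≤ m, f^[s + 1] x ∉ Metric.cthickening (δ m) X := by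
  -- One index governs both the time bound and the distance, so these open sets increase and
  -- compactness selects a single `m`.
  set U : ℕ → Set (Fin n → ℝ) := fun m =>
    ⋃ s ≤ m, (f^[s + 1] ⁻¹' Metric.cthickening (δ m) X)ᶜ
  have hUo : ∀ m, IsOpen (U m) := fun m => isOpen_biUnion fun s _ =>
    (Metric.isClosed_cthickening.preimage (hf.iterate (s + 1))).isOpen_compl
  have hUmono : Monotone U := fun a b hab => iUnion_mono fun s => iUnion_mono' fun hs =>
    ⟨hs.trans hab, compl_subset_compl.2 (preimage_mono (Metric.cthickening_mono (hδ hab) X))⟩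
  have hcover : X ⊆ ⋃ m, U m := fun x hx => by
    obtain ⟨s, hs⟩ := hexit x
    cases s with
    | zero => exact absurd hx hs
    | succ s =>
      have hpos : 0 < Metric.infEDist (f^[s + 1] x) X :=
        Metric.infEDist_pos_iff_notMem_closure.2 (by rwa [hX.isClosed.closure_eq])
      have hlim : Tendsto (fun m => ENNReal.ofReal (δ m)) atTop (𝓝 0) := by
        simpa [Function.comp_def] using (ENNReal.continuous_ofReal.tendsto 0).comp hδ0
      obtain ⟨m, hms, hm⟩ := ((eventually_ge_atTop s).and (hlim.eventually_lt_const hpos)).exists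
      have hout : f^[s + 1] x ∉ Metric.cthickening (δ m) X := by
        rw [Metric.mem_cthickening_iff, not_le]
        exact hm
      exact mem_iUnion.2 ⟨m, mem_iUnion₂.2 ⟨s, hms, hout⟩⟩
  obtain ⟨m, hm⟩ := hX.elim_directed_cover U hUo hcover hUmono.directed_le
  exact ⟨m, fun x hx => by simpa [U] using hm hx⟩

/-- If every trajectory leaves `X`, the dual values approach the volume of the backward reachable
set. -/
theorem le_volume_of_mem_lowerBounds (hf : Continuous f) (hX : IsCompact X) (hZ : IsClosed Z)
    (hZX : Z ⊆ X) (hexit : ∀ x, ∃ s, f^[s] x ∉ X) {b : ℝ}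
    (hb : b ∈ lowerBounds (dualValues X Z f)) :
    b ≤ volume.real (backwardReachInf X Z f) := by
  set δ : ℕ → ℝ := fun m => 1 / ((m : ℝ) + 1)
  have hδpos : ∀ m, 0 < δ m := fun m => Nat.one_div_pos_of_nat
  have hδ : Antitone δ := fun a b hab => Nat.one_div_le_one_div hab
  have hδ0 : Tendsto δ atTop (𝓝 0) := tendsto_one_div_add_atTop_nhds_zero_nat
  have hfin : IsFiniteMeasure (volume.restrict X) := ⟨by simpa using hX.measure_lt_top⟩
  let c : Set (Fin n → ℝ) → ℕ → (Fin n → ℝ) → ℝ := fun S m x => thickenedIndicator (hδpos m) S x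
  have hc : ∀ S m, Continuous (c S m) := fun S m =>
    NNReal.continuous_coe.comp (thickenedIndicator (hδpos m) S).continuous
  have hc0 : ∀ S m x, 0 ≤ c S m x := fun S m x => NNReal.coe_nonneg _
  have hc1 : ∀ S m x, c S m x ≤ 1 := fun S m x => by
    exact_mod_cast thickenedIndicator_le_one (hδpos m) S x
  have hcS : ∀ S m, ∀ x ∈ S, c S m x = 1 := fun S m x hx => by
    simp only [c, thickenedIndicator_one (hδpos m) S hx, NNReal.coe_one]
  have hclim : ∀ S, IsClosed S → ∀ x, Tendsto (fun m => c S m x) atTop (𝓝 (S.indicator 1 x)) := by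
    intro S hS x
    have h := tendsto_pi_nhds.1 (thickenedIndicator_tendsto_indicator_closure hδpos hδ0 S) x
    rw [hS.closure_eq] at h
    have hval : S.indicator (1 : (Fin n → ℝ) → ℝ) x =
        ((S.indicator (fun _ => (1 : NNReal)) x : NNReal) : ℝ) := by
      by_cases hx : x ∈ S <;> simp [hx]
    rw [hval]
    exact (NNReal.continuous_coe.tendsto _).comp h
  -- The depth `T` stays fixed while the cutoff width `δ m` tends to zero; for `m ≥ T` the narrower
  -- cutoff around `X` still vanishes at the exit found here.
  obtain ⟨T, hT⟩ := exists_uniform_exit hf hX hexit hδ hδ0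
  have hle : ∀ᶠ m in atTop, b ≤ ∫ x in X, barrier f (c Z m) (c X m) T x := by
    filter_upwards [eventually_ge_atTop T] with m hm
    refine hb ⟨_, _, dualFeasible_barrier hf (hc Z m) (hc X m) (hc0 Z m) (hcS Z m) (hcS X m)
      (k := T) fun x hx => ?_, rfl⟩
    obtain ⟨s, hs, hsx⟩ := hT x hx
    refine ⟨s, hs, ?_⟩
    have hout : f^[s + 1] x ∉ Metric.thickening (δ m) X := fun h =>
      hsx (Metric.cthickening_mono (hδ hm) X (Metric.thickening_subset_cthickening _ _ h))
    simp only [c, thickenedIndicator_zero (hδpos m) X hout, NNReal.coe_zero]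
  have hlim : Tendsto (fun m => ∫ x in X, barrier f (c Z m) (c X m) T x) atTop
      (𝓝 (∫ x in X, barrier f (Z.indicator 1) (X.indicator 1) T x)) := by
    refine tendsto_integral_of_dominated_convergence (fun _ => (1 : ℝ))
      (fun m => (continuous_barrier hf (hc Z m) (hc X m) T).aestronglyMeasurable)
      (integrable_const _) (fun m => .of_forall fun x => ?_) (.of_forall fun x => ?_)
    · rw [Real.norm_of_nonneg (barrier_nonneg (hc0 Z m) T x)]
      exact barrier_le_one (hc1 Z m) (hc0 X m) (hc1 X m) T x
    · exact tendsto_barrier (hclim Z hZ) (hclim X hX.isClosed) T x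
  refine (ge_of_tendsto hlim hle).trans ?_
  have hA := measurableSet_backwardReach hf hX.measurableSet hZ.measurableSet T
  have hind0 : ∀ (S : Set (Fin n → ℝ)) x, 0 ≤ S.indicator (1 : (Fin n → ℝ) → ℝ) x :=
    fun S x => indicator_nonneg (fun _ _ => zero_le_one) x
  have hind1 : ∀ (S : Set (Fin n → ℝ)) x, S.indicator (1 : (Fin n → ℝ) → ℝ) x ≤ 1 :=
    fun S x => indicator_le_self' (fun _ _ => zero_le_one) x
  calc ∫ x in X, barrier f (Z.indicator 1) (X.indicator 1) T x
      ≤ ∫ x in X, (backwardReach X Z f T).indicator (fun _ => (1 : ℝ)) x := by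
        refine integral_mono_of_nonneg (.of_forall fun x => barrier_nonneg (hind0 Z) T x)
          ((integrable_const _).indicator hA) ?_
        filter_upwards [ae_restrict_mem hX.measurableSet] with x hx
        by_cases hxT : x ∈ backwardReach X Z f T
        · simpa [hxT] using barrier_le_one (hind1 Z) (hind0 X) (hind1 X) T x
        · simp [hxT, barrier_indicator_eq_zero hZX hx hxT]
    _ = volume.real (backwardReach X Z f T) := by
        rw [integral_indicator_const _ hA, measureReal_restrict_apply hA,
          inter_eq_left.2 (backwardReach_subset T)]
        simp
    _ ≤ volume.real (backwardReachInf X Z f) :=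
        measureReal_mono (subset_iUnion _ T)
          (ne_top_of_le_ne_top hX.measure_lt_top.ne (measure_mono backwardReachInf_subset))

theorem isGLB_dualValues (hf : Continuous f) (hX : IsCompact X) (hZ : IsClosed Z)
    (hZX : Z ⊆ X) (hexit : ∀ x, ∃ s, f^[s] x ∉ X) :
    IsGLB (dualValues X Z f) (volume.real (backwardReachInf X Z f)) := by
  refine ⟨?_, fun b hb => le_volume_of_mem_lowerBounds hf hX hZ hZX hexit hb⟩
  rintro _ ⟨v, w, h, rfl⟩
  exact h.volume_le hf hX hZ.measurableSet

end Duality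

theorem proposition1 {n nX nZ : ℕ}
    (F : Fin n → MvPolynomial (Fin n) ℝ)
    (hX : Fin nX → MvPolynomial (Fin n) ℝ) (hZ : Fin nZ → MvPolynomial (Fin n) ℝ)
    (X Z : Set (Fin n → ℝ)) (f : (Fin n → ℝ) → (Fin n → ℝ))
    (hf : f = polyMap F) (hXdef : X = semialgSet hX) (hZdef : Z = semialgSet hZ)
    (hXc : IsCompact X) (hZc : IsCompact Z) (hZX : Z ⊆ X) :
    -- every feasible solution has occupation mass below a common bound: parts (a) and (b);
    -- part (a) needs no invariance of `X` here
    ((∃ M : ℝ, 0 < M ∧ ∀ μ₀ μ₀' ν μ, PrimalFeasible X Z f μ₀ μ₀' ν μ →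
        ∫ _x in X, (1 : ℝ) ∂ν < M) →
      SolvedByBackwardReach X Z f ∧ NoDualityGap X Z f) ∧
    -- part (a) for invariant `X`, where the bound is only required of some feasible solution
    -- with the given initial measure
    (Set.MapsTo f X X →
      (∃ M : ℝ, 0 < M ∧ ∀ μ₀ μ₀' ν μ, PrimalFeasible X Z f μ₀ μ₀' ν μ →
        ∃ ν' μ', PrimalFeasible X Z f μ₀ μ₀' ν' μ' ∧ ∫ _x in X, (1 : ℝ) ∂ν' < M) →
      SolvedByBackwardReach X Z f) := by
  have hfc : Continuous f := hf ▸ continuous_polyMap F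
  have hXm := hXc.measurableSet
  have hZm := hZc.measurableSet
  have hXfin := hXc.measure_lt_top (μ := volume).ne
  refine ⟨fun ⟨M, _, hM⟩ => ?_, fun _ ⟨M, _, hM⟩ =>
    solvedByBackwardReach_of_bound hfc hXm hZm hZX hXfin hM⟩
  have hsol := solvedByBackwardReach_of_bound hfc hXm hZm hZX hXfin (M := M)
    fun μ₀ μ₀' ν μ h => ⟨ν, μ, h, hM _ _ _ _ h⟩
  exact ⟨hsol, _, hsol.2, isGLB_dualValues hfc hXc hZc.isClosed hZX
    (exists_iterate_notMem_of_bound hfc hXc hM)⟩
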